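/- Let $T_3 = \operatorname{conv}\{0, e_1, e_2, e_3\} \subset \mathbb{R}^3$ be the tetrahedron with vertices $(0,0,0)$, $(1,0,0)$, $(0,1,0)$, $(0,0,1)$, and let $c_3 = (1/3, 1/3, 1/3)$ be the centroid of its facet $\{(x,y,z) : x, y, z \ge 0,\ x + y + z = 1\}$. Let $X_0, X_1, X_2$ be independent random points, each uniformly distributed in $T_3$. Let $V_{T_3[3]}$ denote the area (two-dimensional volume) of the convex hull of $X_0, X_1, X_2$, and let $V_{T_3[3],c_3}$ denote the area of the convex hull of $c_3, X_1, X_2$. Then $V_{T_3[3],c_3}$ and $V_{T_3[3]}$ are integrable, and $$\mathbb{E}\, V_{T_3[3],c_3} < \mathbb{E}\, V_{T_3[3]}.$$ -/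

import Mathlib

open MeasureTheory

noncomputable section

/-- The law of `n` independent random points, each uniformly distributed in `K ⊆ ℝᵈ`:
the `n`-fold product of Lebesgue measure conditioned on `K`, i.e. of `vol(K)⁻¹ • vol(· ∩ K)`. -/
def uniformPointsLaw {d : ℕ} (K : Set (EuclideanSpace ℝ (Fin d))) (n : ℕ) :
    Measure (Fin n → EuclideanSpace ℝ (Fin d)) :=
  Measure.pi fun _ => ProbabilityTheory.cond volume K

/-- The `m`-dimensional volume of the convex hull of the `m + 1` points `x 0, …, x m` of `ℝᵈ`.
The measure `μHE[m]` is the `m`-dimensional Hausdorff measure, normalized so that it agrees with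
Lebesgue measure on `m`-dimensional Euclidean space. -/
def simplexVolume {d m : ℕ} (x : Fin (m + 1) → EuclideanSpace ℝ (Fin d)) : ℝ :=
  (μHE[m] (convexHull ℝ (Set.range x))).toReal

/-- `𝔼 V_{K[m+1]}`: the expected `m`-dimensional volume of the convex hull of `m + 1` independent
uniform random points in `K`. -/
def expectedVolume {d : ℕ} (K : Set (EuclideanSpace ℝ (Fin d))) (m : ℕ) : ℝ :=
  ∫ x, simplexVolume x ∂(uniformPointsLaw K (m + 1))

/-- `𝔼 V_{K[m+1],c}`: the expected `m`-dimensional volume of the convex hull of the fixed point `c`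
and `m` independent uniform random points in `K`. -/
def expectedVolumeFixed {d : ℕ} (K : Set (EuclideanSpace ℝ (Fin d))) (m : ℕ)
    (c : EuclideanSpace ℝ (Fin d)) : ℝ :=
  ∫ x : Fin m → EuclideanSpace ℝ (Fin d), simplexVolume (Fin.cons c x : Fin (m + 1) → _)
    ∂(uniformPointsLaw K m)

/-- The tetrahedron with vertices `0`, `e₁`, `e₂`, `e₃`. -/
def T₃ : Set (EuclideanSpace ℝ (Fin 3)) :=
  convexHull ℝ {!₂[0, 0, 0], !₂[1, 0, 0], !₂[0, 1, 0], !₂[0, 0, 1]}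

/-- The centroid of the facet with vertices `e₁`, `e₂`, `e₃`. -/
def c₃ : EuclideanSpace ℝ (Fin 3) :=
  !₂[1 / 3, 1 / 3, 1 / 3]

end

/-! Every triangle is an affine image of one fixed plane triangle, so its area is a fixed positive
constant times the norm of the cross product of two edges (`simplexVolume_eq`). The claim thus
compares two expected norms, and these are separated numerically: the one with a vertex at `c₃` is
at most 0.1081, the other at least 0.1085.

Upper bound (`integral_norm_edgeCross_c₃_le`): the second moment of the norm is a polynomial
integral, equal to 7/600, and its square root is about 0.10801. A tangent-line form of
Cauchy-Schwarz turns this into a bound for the first moment.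

Lower bound (`le_integral_norm_edgeCross`): the cross product is affine in each vertex separately.
If the three points are confined to three given cells, its mean is therefore the cross product of
the cell centroids, and the norm of the mean is at most the mean of the norm
(`mul_norm_edgeCross_le`). A cubic grid of width 1/6 cuts the tetrahedron into 56 cells whose masses
and centroids are rational with small denominators. The resulting sum of square roots over triples
of cells is bounded below in integer arithmetic (`lowerTripleSum_innerCells`). -/

/-! ### Triangle area as the norm of a cross product -/

/-- The cross product `(b - a) × (c - a)` of two edge vectors of the triangle `a b c`. -/
def edgeCross (a b c : EuclideanSpace ℝ (Fin 3)) : EuclideanSpace ℝ (Fin 3) :=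
  !₂[(b 1 - a 1) * (c 2 - a 2) - (b 2 - a 2) * (c 1 - a 1),
    (b 2 - a 2) * (c 0 - a 0) - (b 0 - a 0) * (c 2 - a 2),
    (b 0 - a 0) * (c 1 - a 1) - (b 1 - a 1) * (c 0 - a 0)]

/-- The standard triangle in the plane. -/
def stdTriangle : Set (EuclideanSpace ℝ (Fin 2)) :=
  convexHull ℝ {0, EuclideanSpace.single 0 1, EuclideanSpace.single 1 1}

/-- The linear map sending the standard basis vectors of the plane to `u` and `v`. -/
noncomputable def planeMap (u v : EuclideanSpace ℝ (Fin 3)) :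
    EuclideanSpace ℝ (Fin 2) →ₗ[ℝ] EuclideanSpace ℝ (Fin 3) :=
  (EuclideanSpace.basisFun (Fin 2) ℝ).toBasis.constr ℝ ![u, v]

lemma planeMap_single_zero (u v : EuclideanSpace ℝ (Fin 3)) :
    planeMap u v (EuclideanSpace.single 0 1) = u := by
  simp [planeMap]

lemma planeMap_single_one (u v : EuclideanSpace ℝ (Fin 3)) :
    planeMap u v (EuclideanSpace.single 1 1) = v := by
  simp [planeMap]

lemma norm_edgeCross_sq (a b c : EuclideanSpace ℝ (Fin 3)) :
    ‖edgeCross a b c‖ ^ 2 = edgeCross a b c 0 ^ 2 + edgeCross a b c 1 ^ 2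
      + edgeCross a b c 2 ^ 2 := by
  rw [EuclideanSpace.real_norm_sq_eq, Fin.sum_univ_three]

/-- Lagrange's identity: the Gram determinant of two vectors is the squared norm of their cross
product. -/
lemma normDet_planeMap (a b c : EuclideanSpace ℝ (Fin 3)) :
    (planeMap (b - a) (c - a)).normDet = ‖edgeCross a b c‖ := by
  have h := (planeMap (b - a) (c - a)).normDet_sq_eq_det_gram (EuclideanSpace.basisFun (Fin 2) ℝ)
  rw [← sq_eq_sq₀ (LinearMap.normDet_nonneg _) (norm_nonneg _), norm_edgeCross_sq]
  refine Eq.trans (by exact_mod_cast h) ?_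
  rw [Matrix.det_fin_two]
  simp [Matrix.gram, planeMap_single_zero, planeMap_single_one, edgeCross,
    PiLp.inner_apply, Fin.sum_univ_three]
  ring

lemma simplexVolume_eq (x : Fin 3 → EuclideanSpace ℝ (Fin 3)) :
    simplexVolume (m := 2) x
      = (volume stdTriangle).toReal * ‖edgeCross (x 0) (x 1) (x 2)‖ := by
  have himg : convexHull ℝ (Set.range x)
      = (fun y => x 0 + y) '' (planeMap (x 1 - x 0) (x 2 - x 0) '' stdTriangle) := by
    rw [stdTriangle, LinearMap.image_convexHull]
    have h := (AffineMap.image_convexHull (𝕜 := ℝ)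
      (AffineEquiv.constVAdd ℝ (EuclideanSpace ℝ (Fin 3)) (x 0)).toAffineMap
      ((planeMap (x 1 - x 0) (x 2 - x 0)) ''
        {0, EuclideanSpace.single 0 1, EuclideanSpace.single 1 1}))
    refine Eq.trans ?_ h.symm
    congr 1
    ext y
    simp [Set.image_insert_eq, planeMap_single_zero, planeMap_single_one, Fin.exists_fin_succ,
      eq_comm]
  have h2 := (planeMap (x 1 - x 0) (x 2 - x 0)).euclideanHausdorffMeasure_image_eq_normDet_mul_volume
    stdTriangle
  rw [finrank_euclideanSpace_fin, normDet_planeMap] at h2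
  rw [simplexVolume, himg, (isometry_add_left (x 0)).euclideanHausdorffMeasure_image, h2,
    ENNReal.toReal_mul, ENNReal.toReal_ofReal (norm_nonneg _), mul_comm]

/-- Only the sign matters, since this factor is common to both sides of the final inequality. -/
lemma volume_stdTriangle_pos : 0 < (volume stdTriangle).toReal := by
  have hfin : ({0, EuclideanSpace.single 0 1, EuclideanSpace.single 1 1} :
      Set (EuclideanSpace ℝ (Fin 2))).Finite := by simp
  have hb : Bornology.IsBounded stdTriangle :=
    (isBounded_convexHull).2 hfin.isBounded
  refine ENNReal.toReal_pos ?_ hb.measure_lt_top.ne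
  have hsub : (Metric.ball (!₂[1 / 3, 1 / 3] : EuclideanSpace ℝ (Fin 2)) (1 / 10)) ⊆ stdTriangle := by
    intro y hy
    have h0 : |y 0 - 1 / 3| < 1 / 10 := by
      have := (PiLp.norm_apply_le (y - !₂[1 / 3, 1 / 3]) 0).trans_lt (mem_ball_iff_norm.1 hy)
      simpa using this
    have h1 : |y 1 - 1 / 3| < 1 / 10 := by
      have := (PiLp.norm_apply_le (y - !₂[1 / 3, 1 / 3]) 1).trans_lt (mem_ball_iff_norm.1 hy)
      simpa using this
    rw [abs_lt] at h0 h1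
    have hy' : y = ∑ i : Fin 3, (![1 - y 0 - y 1, y 0, y 1] i) •
        (![0, EuclideanSpace.single 0 1, EuclideanSpace.single 1 1] : Fin 3 →
          EuclideanSpace ℝ (Fin 2)) i := by
      ext i
      fin_cases i <;> simp [Fin.sum_univ_three]
    rw [hy', stdTriangle]
    refine (convex_convexHull ℝ _).sum_mem ?_ ?_ ?_
    · intro i _
      fin_cases i <;> simp <;> linarith
    · simp only [Fin.sum_univ_three, Matrix.cons_val]
      ring
    · intro i _
      refine subset_convexHull ℝ _ ?_
      fin_cases i <;> simp
  exact fun h => (Metric.measure_ball_pos volume (!₂[1 / 3, 1 / 3] : EuclideanSpace ℝ (Fin 2))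
    (by norm_num : (0 : ℝ) < 1 / 10)).ne' (measure_mono_null hsub h)

/-! ### The tetrahedron and its monomial integrals -/

lemma mem_T₃ (x : EuclideanSpace ℝ (Fin 3)) :
    x ∈ T₃ ↔ (∀ i, 0 ≤ x i) ∧ x 0 + x 1 + x 2 ≤ 1 := by
  constructor
  · intro hx
    have hc : Convex ℝ {x : EuclideanSpace ℝ (Fin 3) | (∀ i, 0 ≤ x i) ∧ x 0 + x 1 + x 2 ≤ 1} := by
      rintro x ⟨hx, hx'⟩ y ⟨hy, hy'⟩ a b ha hb hab
      refine ⟨fun i => ?_, ?_⟩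
      · have := mul_nonneg ha (hx i)
        have := mul_nonneg hb (hy i)
        simp only [PiLp.add_apply, PiLp.smul_apply, smul_eq_mul]
        linarith
      · simp only [PiLp.add_apply, PiLp.smul_apply, smul_eq_mul]
        nlinarith
    refine convexHull_min ?_ hc hx
    rintro z (rfl | rfl | rfl | rfl) <;> simp [Fin.forall_fin_succ]
  · rintro ⟨h, h'⟩
    have hx : x = ∑ i : Fin 4, (![1 - x 0 - x 1 - x 2, x 0, x 1, x 2] i) •
        (![!₂[0, 0, 0], !₂[1, 0, 0], !₂[0, 1, 0], !₂[0, 0, 1]] : Fin 4 →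
          EuclideanSpace ℝ (Fin 3)) i := by
      ext i
      fin_cases i <;> simp [Fin.sum_univ_four]
    rw [hx, T₃]
    refine (convex_convexHull ℝ _).sum_mem ?_ ?_ ?_
    · intro i _
      have := h 0
      have := h 1
      have := h 2
      fin_cases i <;> simp <;> linarith
    · simp only [Fin.sum_univ_four, Matrix.cons_val]
      ring
    · intro i _
      refine subset_convexHull ℝ _ ?_
      fin_cases i <;> simp

lemma isCompact_T₃ : IsCompact T₃ := by
  have : ({!₂[0, 0, 0], !₂[1, 0, 0], !₂[0, 1, 0], !₂[0, 0, 1]} :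
    Set (EuclideanSpace ℝ (Fin 3))).Finite := by simp
  exact this.isCompact_convexHull ℝ

/-- Coordinates of `ℝ³` as iterated pairs. -/
noncomputable def tripleEquiv : ℝ × ℝ × ℝ ≃ᵐ EuclideanSpace ℝ (Fin 3) :=
  ((MeasurableEquiv.refl ℝ).prodCongr (MeasurableEquiv.finTwoArrow.symm)).trans
    ((MeasurableEquiv.piFinSuccAbove (fun _ : Fin 3 => ℝ) 0).symm.trans
      (MeasurableEquiv.toLp 2 (Fin 3 → ℝ)))

lemma tripleEquiv_apply (x y z : ℝ) : tripleEquiv (x, y, z) = !₂[x, y, z] := by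
  ext i
  fin_cases i <;> rfl

lemma measurePreserving_tripleEquiv : MeasurePreserving tripleEquiv volume volume := by
  have h1 : MeasurePreserving (MeasurableEquiv.finTwoArrow (α := ℝ)).symm volume volume :=
    (volume_preserving_finTwoArrow ℝ).symm
  have h2 : MeasurePreserving ((MeasurableEquiv.refl ℝ).prodCongr
      (MeasurableEquiv.finTwoArrow (α := ℝ)).symm) volume volume :=
    (MeasurePreserving.id volume).prod h1
  have h3 : MeasurePreserving (MeasurableEquiv.piFinSuccAbove (fun _ : Fin 3 => ℝ) 0).symm
      volume volume := (volume_preserving_piFinSuccAbove (fun _ : Fin 3 => ℝ) 0).symm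
  have h4 : MeasurePreserving (MeasurableEquiv.toLp 2 (Fin 3 → ℝ)) volume volume :=
    (EuclideanSpace.volume_preserving_symm_measurableEquiv_toLp (Fin 3)).symm
  exact h2.trans (h3.trans h4)

lemma setIntegral_T₃ {f : EuclideanSpace ℝ (Fin 3) → ℝ} (hf : Continuous f) :
    ∫ x in T₃, f x = ∫ x in (0 : ℝ)..1, ∫ y in (0 : ℝ)..(1 - x), ∫ z in (0 : ℝ)..(1 - x - y),
      f !₂[x, y, z] := by
  have hm : MeasurableSet T₃ := isCompact_T₃.measurableSet
  have hint : Integrable (T₃.indicator f) :=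
    (hf.continuousOn.integrableOn_compact isCompact_T₃).integrable_indicator hm
  have hint' : Integrable (fun p => T₃.indicator f (tripleEquiv p)) :=
    (measurePreserving_tripleEquiv.integrable_comp_emb
      tripleEquiv.measurableEmbedding).2 hint
  rw [← integral_indicator hm, ← measurePreserving_tripleEquiv.integral_comp
    tripleEquiv.measurableEmbedding, Measure.volume_eq_prod, integral_prod _ hint']
  -- Nesting the indicators lets each variable's range depend on the preceding ones, as in the
  -- iterated integral.
  have key : ∀ x y z : ℝ, T₃.indicator f (tripleEquiv (x, y, z)) =
      (Set.Icc 0 1).indicator (fun x => (Set.Icc 0 (1 - x)).indicator (fun y =>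
        (Set.Icc 0 (1 - x - y)).indicator (fun z => f !₂[x, y, z]) z) y) x := by
    intro x y z
    rw [tripleEquiv_apply]
    by_cases h : !₂[x, y, z] ∈ T₃
    · rw [Set.indicator_of_mem h]
      rw [mem_T₃] at h
      simp [Fin.forall_fin_succ] at h
      rw [Set.indicator_of_mem, Set.indicator_of_mem, Set.indicator_of_mem] <;>
        constructor <;> linarith
    · rw [Set.indicator_of_notMem h]
      rw [mem_T₃] at h
      simp [Fin.forall_fin_succ] at h
      simp only [Set.indicator_apply, Set.mem_Icc]
      split_ifs with h1 h2 h3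
      · have := h h1.1 h2.1 h3.1
        linarith
      all_goals rfl
  rw [intervalIntegral.integral_of_le zero_le_one, ← integral_Icc_eq_integral_Ioc,
    ← integral_indicator measurableSet_Icc]
  refine integral_congr_ae ?_
  filter_upwards [hint'.prod_right_ae] with x hx
  rw [Measure.volume_eq_prod, integral_prod _ hx]
  simp only [key]
  by_cases h1 : x ∈ Set.Icc (0 : ℝ) 1
  · simp only [Set.indicator_of_mem h1]
    rw [intervalIntegral.integral_of_le (by linarith [h1.2]), ← integral_Icc_eq_integral_Ioc,
      ← integral_indicator measurableSet_Icc]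
    congr 1
    ext y
    by_cases h2 : y ∈ Set.Icc (0 : ℝ) (1 - x)
    · simp only [Set.indicator_of_mem h2]
      rw [intervalIntegral.integral_of_le (by linarith [h2.2]), ← integral_Icc_eq_integral_Ioc,
        ← integral_indicator measurableSet_Icc]
    · simp only [Set.indicator_of_notMem h2, integral_zero]
  · simp only [Set.indicator_of_notMem h1, integral_zero]

lemma integral_pow_mul_sub_pow (c : ℝ) (a b : ℕ) :
    ∫ y in (0 : ℝ)..c, y ^ a * (c - y) ^ b
      = (a.factorial * b.factorial : ℝ) / (a + b + 1).factorial * c ^ (a + b + 1) := by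
  induction a generalizing b with
  | zero =>
    have h := intervalIntegral.integral_comp_sub_left (a := 0) (b := c) (fun u : ℝ => u ^ b) c
    simp only [pow_zero, one_mul]
    rw [h, sub_self, sub_zero, integral_pow, zero_add, Nat.factorial_succ]
    have : (b.factorial : ℝ) ≠ 0 := by positivity
    push_cast
    field_simp
    simp
  | succ a ih =>
    -- Integration by parts: the boundary terms vanish, and one power of `y` is traded for one of `c
    -- - y`. This is why the induction must be uniform in `b`.
    have hd : ∀ y ∈ Set.uIcc 0 c, HasDerivAt (fun y : ℝ => y ^ (a + 1) * (c - y) ^ (b + 1))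
        ((a + 1) * (y ^ a * (c - y) ^ (b + 1)) - (b + 1) * (y ^ (a + 1) * (c - y) ^ b)) y := by
      intro y _
      have h1 := hasDerivAt_pow (a + 1) y
      have h2 := ((hasDerivAt_id y).const_sub c).pow (b + 1)
      refine (h1.mul h2).congr_deriv ?_
      simp
      ring
    have hi : ∀ m n : ℕ, IntervalIntegrable (fun y : ℝ => y ^ m * (c - y) ^ n) volume 0 c :=
      fun m n => (by fun_prop : Continuous fun y : ℝ => y ^ m * (c - y) ^ n).intervalIntegrable _ _
    have h := intervalIntegral.integral_eq_sub_of_hasDerivAt hd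
      (((hi _ _).const_mul _).sub ((hi _ _).const_mul _))
    rw [intervalIntegral.integral_sub ((hi _ _).const_mul _) ((hi _ _).const_mul _),
      intervalIntegral.integral_const_mul, intervalIntegral.integral_const_mul, ih] at h
    have hb : (b + 1 : ℝ) ≠ 0 := by positivity
    have h' : ∫ y in (0 : ℝ)..c, y ^ (a + 1) * (c - y) ^ b = (a + 1) / (b + 1) *
      ((a.factorial * (b + 1).factorial : ℝ) / (a + (b + 1) + 1).factorial *
        c ^ (a + (b + 1) + 1)) := by
      simp at h
      rw [div_mul_eq_mul_div, eq_div_iff hb]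
      linarith
    rw [h', show a + 1 + b + 1 = a + (b + 1) + 1 by ring, Nat.factorial_succ a,
      Nat.factorial_succ b]
    push_cast
    field_simp

lemma setIntegral_T₃_monomial (a b c : ℕ) :
    ∫ x in T₃, x 0 ^ a * x 1 ^ b * x 2 ^ c
      = (a.factorial * b.factorial * c.factorial : ℝ) / (a + b + c + 3).factorial := by
  rw [setIntegral_T₃ (by fun_prop)]
  have h1 : ∀ x y : ℝ, ∫ z in (0 : ℝ)..(1 - x - y), x ^ a * y ^ b * z ^ c
      = x ^ a * (1 / (c + 1)) * (y ^ b * ((1 - x) - y) ^ (c + 1)) := by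
    intro x y
    rw [intervalIntegral.integral_const_mul, integral_pow]
    simp
    ring
  have h2 : ∀ x : ℝ, ∫ y in (0 : ℝ)..(1 - x), x ^ a * (1 / (c + 1)) *
        (y ^ b * ((1 - x) - y) ^ (c + 1))
      = (1 / (c + 1)) * ((b.factorial * (c + 1).factorial : ℝ) / (b + (c + 1) + 1).factorial) *
        (x ^ a * (1 - x) ^ (b + (c + 1) + 1)) := by
    intro x
    rw [intervalIntegral.integral_const_mul, integral_pow_mul_sub_pow]
    ring
  simp only [Matrix.cons_val, h1, h2]
  rw [intervalIntegral.integral_const_mul, integral_pow_mul_sub_pow,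
    show a + (b + (c + 1) + 1) + 1 = a + b + c + 3 by ring, Nat.factorial_succ c]
  push_cast
  field_simp
  simp

/-! ### Planes are null sets -/

lemma volume_inner_eq_const {v : EuclideanSpace ℝ (Fin 3)} (hv : v ≠ 0) (c : ℝ) :
    volume {x | inner ℝ v x = c} = 0 := by
  rcases Set.eq_empty_or_nonempty {x | inner ℝ v x = c} with h | ⟨p, hp⟩
  · rw [h, measure_empty]
  · have hset : {x | inner ℝ v x = c}
        = (AffineSubspace.mk' p (ℝ ∙ v)ᗮ : Set (EuclideanSpace ℝ (Fin 3))) := by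
      ext x
      have hp' : inner ℝ v p = c := hp
      simp [AffineSubspace.mem_mk', Submodule.mem_orthogonal_singleton_iff_inner_right,
        inner_sub_right, hp', sub_eq_zero]
    rw [hset]
    refine Measure.addHaar_affineSubspace _ _ fun htop => hv ?_
    have : p + v ∈ AffineSubspace.mk' p (ℝ ∙ v)ᗮ := by rw [htop]; trivial
    simpa [AffineSubspace.mem_mk', Submodule.mem_orthogonal_singleton_iff_inner_right] using this

lemma ae_coord_ne (i : Fin 3) (c : ℝ) : ∀ᵐ x : EuclideanSpace ℝ (Fin 3), x i ≠ c := by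
  have h := volume_inner_eq_const (v := EuclideanSpace.single i 1) (by simp) c
  rw [ae_iff]
  simpa [PiLp.inner_apply, PiLp.single_apply] using h

lemma ae_sum_ne (c : ℝ) : ∀ᵐ x : EuclideanSpace ℝ (Fin 3), x 0 + x 1 + x 2 ≠ c := by
  have hv : (!₂[1, 1, 1] : EuclideanSpace ℝ (Fin 3)) ≠ 0 := by
    intro h
    simpa using congrArg (fun x : EuclideanSpace ℝ (Fin 3) => x 0) h
  have h := volume_inner_eq_const hv c
  rw [ae_iff]
  simpa [PiLp.inner_apply, Fin.sum_univ_three] using h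

/-! ### Volume and centroid of the unit cube cut by a diagonal plane -/

/-- The half-open unit cube. -/
def unitCube : Set (EuclideanSpace ℝ (Fin 3)) := {x | ∀ i, 0 ≤ x i ∧ x i < 1}

/-- The part of the unit cube below the plane of height `t`. -/
def cubePart (t : ℝ) : Set (EuclideanSpace ℝ (Fin 3)) := {x ∈ unitCube | x 0 + x 1 + x 2 ≤ t}

lemma measurableSet_unitCube : MeasurableSet unitCube := by
  refine MeasurableSet.congr (s := ⋂ i : Fin 3, {x : EuclideanSpace ℝ (Fin 3) | 0 ≤ x i} ∩
    {x | x i < 1}) ?_ (by ext; simp [unitCube])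
  exact MeasurableSet.iInter fun i =>
    (measurableSet_le measurable_const (by fun_prop)).inter
      (measurableSet_lt (by fun_prop) measurable_const)

lemma measurableSet_cubePart (t : ℝ) : MeasurableSet (cubePart t) :=
  measurableSet_unitCube.inter (measurableSet_le
    (by fun_prop : Measurable fun x : EuclideanSpace ℝ (Fin 3) => x 0 + x 1 + x 2)
    measurable_const)

lemma isBounded_unitCube : Bornology.IsBounded unitCube := by
  refine (Metric.isBounded_iff_subset_closedBall 0).2 ⟨√3, fun x hx => ?_⟩
  rw [mem_closedBall_zero_iff, EuclideanSpace.norm_eq]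
  refine Real.sqrt_le_sqrt ?_
  calc ∑ i, ‖x i‖ ^ 2 ≤ ∑ _i : Fin 3, (1 : ℝ) := by
        refine Finset.sum_le_sum fun i _ => ?_
        rw [Real.norm_eq_abs, abs_of_nonneg (hx i).1]
        nlinarith [(hx i).1, (hx i).2]
    _ = 3 := by simp

lemma integrableOn_unitCube {f : EuclideanSpace ℝ (Fin 3) → ℝ} (hf : Continuous f) :
    IntegrableOn f unitCube :=
  (hf.continuousOn.integrableOn_compact isBounded_unitCube.isCompact_closure).mono_set
    subset_closure

lemma volume_unitCube : volume unitCube = 1 := by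
  have h : unitCube = (MeasurableEquiv.toLp 2 (Fin 3 → ℝ)).symm ⁻¹'
      Set.pi Set.univ fun _ => Set.Ico (0 : ℝ) 1 := by
    ext; simp [unitCube]
  rw [h, (EuclideanSpace.volume_preserving_symm_measurableEquiv_toLp (Fin 3)).measure_preimage_equiv,
    Real.volume_pi_Ico]
  simp

/-- The vector with all coordinates `1`. -/
noncomputable def onesVec : EuclideanSpace ℝ (Fin 3) := !₂[1, 1, 1]

lemma onesVec_sub_apply (x : EuclideanSpace ℝ (Fin 3)) (i : Fin 3) :
    (onesVec - x) i = 1 - x i := by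
  fin_cases i <;> simp [onesVec]

/-- Reflection in the centre of the unit cube. -/
lemma integral_reflect (f : EuclideanSpace ℝ (Fin 3) → ℝ) :
    ∫ x, f (onesVec - x) = ∫ x, f x :=
  integral_sub_left_eq_self f volume _

lemma setIntegral_unitCube_coord (i : Fin 3) : ∫ x in unitCube, x i = 1 / 2 := by
  have h := integral_reflect (unitCube.indicator fun x => x i)
  rw [integral_indicator measurableSet_unitCube] at h
  have h2 : ∫ x, unitCube.indicator (fun x => x i) (onesVec - x)
      = ∫ x in unitCube, (1 - x i) := by
    rw [← integral_indicator measurableSet_unitCube]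
    refine integral_congr_ae ?_
    filter_upwards [ae_coord_ne 0 0, ae_coord_ne 1 0, ae_coord_ne 2 0, ae_coord_ne 0 1,
      ae_coord_ne 1 1, ae_coord_ne 2 1] with x h1 h2 h3 h4 h5 h6
    -- The reflection exchanges the closed and open faces of the cube, so this needs the faces to be
    -- excluded.
    have hiff : onesVec - x ∈ unitCube ↔ x ∈ unitCube := by
      simp only [unitCube, Set.mem_ofPred_eq, Fin.forall_fin_succ, onesVec_sub_apply]
      simp [le_iff_lt_or_eq, sub_eq_zero, Ne.symm h1, Ne.symm h2, Ne.symm h3,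
        eq_comm (a := (0 : ℝ))]
      tauto
    by_cases hx : x ∈ unitCube
    · rw [Set.indicator_of_mem hx, Set.indicator_of_mem (hiff.2 hx)]
      exact onesVec_sub_apply x i
    · rw [Set.indicator_of_notMem hx, Set.indicator_of_notMem (hiff.not.2 hx)]
  rw [h2, integral_sub (integrableOn_unitCube continuous_const)
    (integrableOn_unitCube (by fun_prop))] at h
  have h3 : ∫ _ in unitCube, (1 : ℝ) = 1 := by simp [Measure.real, volume_unitCube]
  linarith

lemma setIntegral_T₃_one : ∫ _ in T₃, (1 : ℝ) = 1 / 6 := by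
  have := setIntegral_T₃_monomial 0 0 0
  simpa [Nat.factorial] using this

lemma setIntegral_T₃_coord (i : Fin 3) : ∫ x in T₃, x i = 1 / 24 := by
  have h0 := setIntegral_T₃_monomial 1 0 0
  have h1 := setIntegral_T₃_monomial 0 1 0
  have h2 := setIntegral_T₃_monomial 0 0 1
  simp [Nat.factorial] at h0 h1 h2
  fin_cases i <;> simp [h0, h1, h2]

lemma integrableOn_T₃ {f : EuclideanSpace ℝ (Fin 3) → ℝ} (hf : Continuous f) :
    IntegrableOn f T₃ :=
  hf.continuousOn.integrableOn_compact isCompact_T₃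

lemma cubePart_one_ae_eq : cubePart 1 =ᵐ[volume] T₃ := by
  filter_upwards [ae_coord_ne 0 1, ae_coord_ne 1 1, ae_coord_ne 2 1] with x h1 h2 h3
  refine propext ?_
  change x ∈ cubePart 1 ↔ x ∈ T₃
  rw [mem_T₃]
  simp only [cubePart, unitCube, Set.mem_ofPred_eq, Fin.forall_fin_succ]
  simp only [Fin.succ_zero_eq_one, Fin.succ_one_eq_two, IsEmpty.forall_iff, and_true]
  constructor
  · rintro ⟨⟨⟨a, _⟩, ⟨b, _⟩, c, _⟩, d⟩
    exact ⟨⟨a, b, c⟩, d⟩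
  · rintro ⟨⟨a, b, c⟩, d⟩
    exact ⟨⟨⟨a, lt_of_le_of_ne (by linarith) h1⟩, ⟨b, lt_of_le_of_ne (by linarith) h2⟩,
      c, lt_of_le_of_ne (by linarith) h3⟩, d⟩

/-- The corner of the cube removed by the plane of height 2 is, up to a null set, the reflection of
`T₃` in the centre of the cube. -/
lemma setIntegral_cubePart_two {f : EuclideanSpace ℝ (Fin 3) → ℝ} (hf : Continuous f) :
    ∫ x in cubePart 2, f x = (∫ x in unitCube, f x) - ∫ x in T₃, f (onesVec - x) := by
  have hd := setIntegral_sdiff (f := f) (measurableSet_cubePart 2) (integrableOn_unitCube hf)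
    (fun x hx => hx.1 : cubePart 2 ⊆ unitCube)
  have h2 : ∫ x in T₃, f (onesVec - x) = ∫ x in unitCube \ cubePart 2, f x := by
    have hm := measurableSet_unitCube.diff (measurableSet_cubePart 2)
    rw [← integral_indicator hm, ← integral_reflect,
      ← integral_indicator isCompact_T₃.measurableSet]
    refine integral_congr_ae ?_
    filter_upwards [ae_coord_ne 0 0, ae_coord_ne 1 0, ae_coord_ne 2 0, ae_sum_ne 1]
      with x h1 h2 h3 h4
    have hiff : onesVec - x ∈ unitCube \ cubePart 2 ↔ x ∈ T₃ := by
      rw [mem_T₃]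
      simp only [onesVec_sub_apply, cubePart, unitCube, Set.mem_sdiff, Set.mem_ofPred_eq, Fin.forall_fin_succ]
      simp
      constructor
      · rintro ⟨⟨⟨a, a'⟩, ⟨b, b'⟩, c, c'⟩, d⟩
        have := d a a' b b' c c'
        exact ⟨⟨a'.le, b'.le, c'.le⟩, by linarith⟩
      · rintro ⟨⟨a, b, c⟩, d⟩
        have ha := lt_of_le_of_ne a (Ne.symm h1)
        have hb := lt_of_le_of_ne b (Ne.symm h2)
        have hc := lt_of_le_of_ne c (Ne.symm h3)
        have hd := lt_of_le_of_ne d h4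
        refine ⟨⟨⟨?_, ?_⟩, ⟨?_, ?_⟩, ?_, ?_⟩, fun _ _ _ _ _ _ => ?_⟩ <;> linarith
    by_cases hx : x ∈ T₃
    · rw [Set.indicator_of_mem hx, Set.indicator_of_mem (hiff.2 hx)]
    · rw [Set.indicator_of_notMem hx, Set.indicator_of_notMem (hiff.not.2 hx)]
  linarith

/-- Six times the volume of `cubePart n`, for `1 ≤ n`. -/
def partWeight (n : ℕ) : ℕ := if n = 1 then 1 else if n = 2 then 5 else 6

/-- Twenty times each coordinate of the centroid of `cubePart n`, for `1 ≤ n`. -/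
def partCentroid (n : ℕ) : ℕ := if n = 1 then 5 else if n = 2 then 9 else 10

lemma setIntegral_cubePart_one {n : ℕ} (hn : 1 ≤ n) :
    ∫ _ in cubePart n, (1 : ℝ) = partWeight n / 6 := by
  have h1 : ∫ _ in unitCube, (1 : ℝ) = 1 := by simp [Measure.real, volume_unitCube]
  rcases (by omega : n = 1 ∨ n = 2 ∨ 3 ≤ n) with rfl | rfl | h3
  · rw [Nat.cast_one, setIntegral_congr_set cubePart_one_ae_eq, setIntegral_T₃_one]
    simp [partWeight]
  · rw [Nat.cast_two, setIntegral_cubePart_two continuous_const, setIntegral_T₃_one, h1]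
    norm_num [partWeight]
  · have h : cubePart n = unitCube := by
      refine Set.Subset.antisymm (fun x hx => hx.1) fun x hx => ⟨hx, ?_⟩
      have : (3 : ℝ) ≤ n := by exact_mod_cast h3
      linarith [(hx 0).2, (hx 1).2, (hx 2).2]
    rw [h, h1, partWeight, if_neg (by omega), if_neg (by omega)]
    norm_num

lemma setIntegral_cubePart_coord {n : ℕ} (hn : 1 ≤ n) (i : Fin 3) :
    ∫ x in cubePart n, x i = partWeight n / 6 * (partCentroid n / 20) := by
  rcases (by omega : n = 1 ∨ n = 2 ∨ 3 ≤ n) with rfl | rfl | h3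
  · rw [Nat.cast_one, setIntegral_congr_set cubePart_one_ae_eq, setIntegral_T₃_coord]
    norm_num [partWeight, partCentroid]
  · rw [Nat.cast_two, setIntegral_cubePart_two (by fun_prop), setIntegral_unitCube_coord]
    simp only [onesVec_sub_apply]
    rw [integral_sub (integrableOn_T₃ continuous_const) (integrableOn_T₃ (by fun_prop)),
      setIntegral_T₃_one, setIntegral_T₃_coord]
    norm_num [partWeight, partCentroid]
  · have h : cubePart n = unitCube := by
      refine Set.Subset.antisymm (fun x hx => hx.1) fun x hx => ⟨hx, ?_⟩
      have : (3 : ℝ) ≤ n := by exact_mod_cast h3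
      linarith [(hx 0).2, (hx 1).2, (hx 2).2]
    rw [h, setIntegral_unitCube_coord, partWeight, partCentroid, if_neg (by omega),
      if_neg (by omega), if_neg (by omega), if_neg (by omega)]
    norm_num

/-! ### Mass and centroid of the grid cells -/

/-- The lower corner of a grid cell, in units of the grid width. -/
def cellCorner (p : ℕ × ℕ × ℕ) : EuclideanSpace ℝ (Fin 3) := !₂[(p.1 : ℝ), p.2.1, p.2.2]

/-- The sum of the indices of a grid cell. -/
def cellHeight (p : ℕ × ℕ × ℕ) : ℕ := p.1 + p.2.1 + p.2.2

/-- A cell of the cubic grid of width `1 / 6`. -/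
def cell (p : ℕ × ℕ × ℕ) : Set (EuclideanSpace ℝ (Fin 3)) :=
  {x | (6 : ℝ) • x - cellCorner p ∈ unitCube}

lemma measurableSet_cell (p : ℕ × ℕ × ℕ) : MeasurableSet (cell p) :=
  measurableSet_unitCube.preimage (by fun_prop)

lemma cell_eq_of_mem {p q : ℕ × ℕ × ℕ} {x : EuclideanSpace ℝ (Fin 3)} (hp : x ∈ cell p)
    (hq : x ∈ cell q) : p = q := by
  have key : ∀ (t : ℝ) (m n : ℕ), 0 ≤ t - m → t - m < 1 → 0 ≤ t - n → t - n < 1 → m = n := by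
    intro t m n h1 h2 h3 h4
    have h5 : (m : ℝ) < n + 1 := by linarith
    have h6 : (n : ℝ) < m + 1 := by linarith
    norm_cast at h5 h6
    omega
  obtain ⟨p0, p1, p2⟩ := p
  obtain ⟨q0, q1, q2⟩ := q
  simp only [cell, unitCube, Set.mem_ofPred_eq, Fin.forall_fin_succ, cellCorner] at hp hq
  simp at hp hq
  obtain ⟨⟨a1, a2⟩, ⟨a3, a4⟩, a5, a6⟩ := hp
  obtain ⟨⟨b1, b2⟩, ⟨b3, b4⟩, b5, b6⟩ := hq
  rw [key (6 * x 0) p0 q0 (by linarith) (by linarith) (by linarith) (by linarith),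
    key (6 * x 1) p1 q1 (by linarith) (by linarith) (by linarith) (by linarith),
    key (6 * x 2) p2 q2 (by linarith) (by linarith) (by linarith) (by linarith)]

/-- In a cell the coordinates are automatically nonnegative, so only the slanted facet cuts it.
After rescaling, that facet lies at height `6 - cellHeight p`, where `hp` makes the truncated
subtraction exact. -/
lemma cell_inter_T₃ {p : ℕ × ℕ × ℕ} (hp : cellHeight p ≤ 5) :
    cell p ∩ T₃ = {x | (6 : ℝ) • x - cellCorner p ∈ cubePart ((6 - cellHeight p : ℕ) : ℝ)} := by
  ext x
  obtain ⟨i, j, k⟩ := p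
  have hs : ((6 - cellHeight (i, j, k) : ℕ) : ℝ) = 6 - i - j - k := by
    rw [Nat.cast_sub (by omega)]
    simp [cellHeight]
    ring
  have hi : (0 : ℝ) ≤ i := i.cast_nonneg
  have hj : (0 : ℝ) ≤ j := j.cast_nonneg
  have hk : (0 : ℝ) ≤ k := k.cast_nonneg
  rw [Set.mem_inter_iff, mem_T₃, hs]
  simp only [cell, cubePart, unitCube, Set.mem_ofPred_eq, Fin.forall_fin_succ, cellCorner]
  simp
  rintro a1 a2 a3 a4 a5 a6
  constructor
  · rintro ⟨_, h⟩
    linarith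
  · intro h
    refine ⟨⟨?_, ?_, ?_⟩, ?_⟩ <;> linarith

lemma setIntegral_cell_inter_T₃ {p : ℕ × ℕ × ℕ} (hp : cellHeight p ≤ 5)
    (f : EuclideanSpace ℝ (Fin 3) → ℝ) :
    ∫ x in cell p ∩ T₃, f x
      = (1 / 216) * ∫ y in cubePart ((6 - cellHeight p : ℕ) : ℝ),
        f ((1 / 6 : ℝ) • (y + cellCorner p)) := by
  set G := cubePart ((6 - cellHeight p : ℕ) : ℝ) with hG
  have h1 := integral_sub_right_eq_self (μ := (volume : Measure (EuclideanSpace ℝ (Fin 3))))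
    (G.indicator fun y => f ((1 / 6 : ℝ) • (y + cellCorner p))) (cellCorner p)
  have h2 := Measure.integral_comp_smul (volume : Measure (EuclideanSpace ℝ (Fin 3)))
    (fun x => (G.indicator fun y => f ((1 / 6 : ℝ) • (y + cellCorner p))) (x - cellCorner p)) 6
  rw [h1, integral_indicator (measurableSet_cubePart _), ← hG] at h2
  rw [← integral_indicator ((measurableSet_cell p).inter isCompact_T₃.measurableSet)]
  refine Eq.trans ?_ (h2.trans ?_)
  · congr 1
    ext x
    rw [cell_inter_T₃ hp, ← hG]
    by_cases hx : (6 : ℝ) • x - cellCorner p ∈ G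
    · rw [Set.indicator_of_mem (show x ∈ {x | (6 : ℝ) • x - cellCorner p ∈ G} from hx),
        Set.indicator_of_mem hx]
      simp [smul_smul]
    · rw [Set.indicator_of_notMem (show x ∉ {x | (6 : ℝ) • x - cellCorner p ∈ G} from hx),
        Set.indicator_of_notMem hx]
  · rw [finrank_euclideanSpace_fin, smul_eq_mul]
    norm_num

lemma setIntegral_cell_one {p : ℕ × ℕ × ℕ} (hp : cellHeight p ≤ 5) :
    ∫ _ in cell p ∩ T₃, (1 : ℝ) = partWeight (6 - cellHeight p) / 1296 := by
  rw [setIntegral_cell_inter_T₃ hp, setIntegral_cubePart_one (by omega)]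
  ring

lemma setIntegral_cell_coord {p : ℕ × ℕ × ℕ} (hp : cellHeight p ≤ 5) (i : Fin 3) :
    ∫ x in cell p ∩ T₃, x i = partWeight (6 - cellHeight p) / 1296 *
      ((cellCorner p i * 20 + partCentroid (6 - cellHeight p)) / 120) := by
  have hsub : ∀ {f : EuclideanSpace ℝ (Fin 3) → ℝ}, Continuous f →
      IntegrableOn f (cubePart ((6 - cellHeight p : ℕ) : ℝ)) :=
    fun hf => (integrableOn_unitCube hf).mono_set fun x hx => hx.1
  rw [setIntegral_cell_inter_T₃ hp]
  simp only [PiLp.smul_apply, PiLp.add_apply, smul_eq_mul]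
  have h1 := setIntegral_cubePart_one (n := 6 - cellHeight p) (by omega)
  have h : ∫ y in cubePart ((6 - cellHeight p : ℕ) : ℝ), cellCorner p i
      = cellCorner p i * (partWeight (6 - cellHeight p) / 6) := by
    rw [← h1, ← integral_const_mul]
    simp
  rw [integral_const_mul, integral_add (hsub (by fun_prop)) (hsub continuous_const),
    setIntegral_cubePart_coord (by omega), h]
  ring

/-! ### Integer lower bounds for sums of square roots -/

/-- A point of the grid of width `1 / 120` together with a weight. -/
structure WeightedPoint where
  /-- the weight -/
  weight : ℕ
  /-- the first coordinate, in grid units -/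
  x : ℕ
  /-- the second coordinate, in grid units -/
  y : ℕ
  /-- the third coordinate, in grid units -/
  z : ℕ

namespace WeightedPoint

/-! The following functions are evaluated by the kernel on some 28,000 triples, so they use the
operations on `ℕ` directly, without type class instances. -/

/-- The distance between two natural numbers. -/
def natDiff (m n : ℕ) : ℕ := Nat.add (Nat.sub m n) (Nat.sub n m)

/-- Twice the area of a triangle in the plane. -/
def planarArea (a₁ a₂ b₁ b₂ c₁ c₂ : ℕ) : ℕ :=
  natDiff (Nat.add (Nat.add (Nat.mul b₁ c₂) (Nat.mul b₂ a₁)) (Nat.mul a₂ c₁))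
    (Nat.add (Nat.add (Nat.mul b₁ a₂) (Nat.mul a₁ c₂)) (Nat.mul b₂ c₁))

/-- The square of a natural number. -/
def natSq (n : ℕ) : ℕ := Nat.mul n n

/-- The squared norm of the cross product of two edges of a triangle. -/
def crossSq (a b c : WeightedPoint) : ℕ :=
  Nat.add (natSq (planarArea a.y a.z b.y b.z c.y c.z))
    (Nat.add (natSq (planarArea a.z a.x b.z b.x c.z c.x))
      (natSq (planarArea a.x a.y b.x b.y c.x c.y)))

/-- The harmonic mean of `r` and `q / r`, a lower approximation of `√q`. -/
def harmonicSqrt (q r : ℕ) : ℕ :=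
  Nat.div (Nat.mul (Nat.mul 2 q) r) (Nat.add (Nat.mul r r) q)

/-- One Newton step towards `√q`. -/
def newtonStep (q r : ℕ) : ℕ := Nat.div (Nat.add r (Nat.div q r)) 2

/-- A lower approximation of `√q`. -/
def sqrtLower (q : ℕ) : ℕ :=
  harmonicSqrt q (newtonStep q (Nat.pow 2 (Nat.div (Nat.add (Nat.log2 q) 1) 2)))

/-- A lower bound for the weighted norm of the cross product of two edges of a triangle. -/
def lowerTerm (a b c : WeightedPoint) : ℕ :=
  Nat.mul (Nat.mul a.weight (Nat.mul b.weight c.weight)) (sqrtLower (crossSq a b c))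

/-- The sum of `lowerTerm a b c` over the entries `c` of a list. -/
def lowerSum (a b : WeightedPoint) (l : List WeightedPoint) : ℕ :=
  List.rec (motive := fun _ => ℕ) 0 (fun c _ s => Nat.add (lowerTerm a b c) s) l

/-- The sum of `lowerTerm a b c` over the unordered pairs `b, c` of entries of a list. -/
def lowerPairSum (a : WeightedPoint) (l : List WeightedPoint) : ℕ :=
  List.rec (motive := fun _ => ℕ) 0 (fun b l s => Nat.add (lowerSum a b l) s) l

/-- The sum of `lowerTerm a b c` over the unordered triples of entries of a list. -/
def lowerTripleSum (l : List WeightedPoint) : ℕ :=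
  List.rec (motive := fun _ => ℕ) 0 (fun a l s => Nat.add (lowerPairSum a l) s) l

/-- By AM-GM, `r * r + q ≥ 2 * r * √q`. The bound holds for every `r`, so nothing need be proved
about the quality of the Newton step that supplies it. -/
lemma harmonicSqrt_le_sqrt (q r : ℕ) : (harmonicSqrt q r : ℝ) ≤ √q := by
  have h : harmonicSqrt q r = (2 * q * r) / (r * r + q) := rfl
  have hq : (0 : ℝ) ≤ √q := Real.sqrt_nonneg _
  have hs : √(q : ℝ) * √q = q := Real.mul_self_sqrt (Nat.cast_nonneg q)
  rw [h]
  refine Nat.cast_div_le.trans (div_le_of_le_mul₀ (by positivity) hq ?_)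
  push_cast
  nlinarith [mul_nonneg hq (sq_nonneg ((r : ℝ) - √q))]

/-- The weighted norm of the cross product of two edges of a triangle. -/
noncomputable def weightedCross (a b c : WeightedPoint) : ℝ :=
  a.weight * b.weight * c.weight * √(crossSq a b c)

lemma lowerTerm_le (a b c : WeightedPoint) : (lowerTerm a b c : ℝ) ≤ weightedCross a b c := by
  have h : lowerTerm a b c = a.weight * (b.weight * c.weight) * sqrtLower (crossSq a b c) := rfl
  rw [h, weightedCross]
  push_cast
  rw [mul_assoc (a.weight : ℝ) (b.weight : ℝ) (c.weight : ℝ)]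
  exact mul_le_mul_of_nonneg_left (harmonicSqrt_le_sqrt _ _)
    (mul_nonneg (Nat.cast_nonneg _) (mul_nonneg (Nat.cast_nonneg _) (Nat.cast_nonneg _)))

lemma weightedCross_nonneg (a b c : WeightedPoint) : 0 ≤ weightedCross a b c := by
  unfold weightedCross
  positivity

/-- The position of a weighted point in space. -/
noncomputable def toSpace (a : WeightedPoint) : EuclideanSpace ℝ (Fin 3) :=
  !₂[(a.x : ℝ) / 120, (a.y : ℝ) / 120, (a.z : ℝ) / 120]

lemma natSq_planarArea (a₁ a₂ b₁ b₂ c₁ c₂ : ℕ) : (natSq (planarArea a₁ a₂ b₁ b₂ c₁ c₂) : ℝ)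
    = (((b₁ : ℝ) - a₁) * (c₂ - a₂) - (b₂ - a₂) * (c₁ - a₁)) ^ 2 := by
  have hd : ∀ m n : ℕ, (natSq (natDiff m n) : ℝ) = ((m : ℝ) - n) ^ 2 := by
    intro m n
    have h : natSq (natDiff m n) = ((m - n) + (n - m)) * ((m - n) + (n - m)) := rfl
    rcases le_total m n with hmn | hmn
    · rw [h, Nat.sub_eq_zero_of_le hmn, zero_add, Nat.cast_mul, Nat.cast_sub hmn]
      ring
    · rw [h, Nat.sub_eq_zero_of_le hmn, add_zero, Nat.cast_mul, Nat.cast_sub hmn]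
      ring
  rw [planarArea, hd]
  have h1 : Nat.add (Nat.add (Nat.mul b₁ c₂) (Nat.mul b₂ a₁)) (Nat.mul a₂ c₁)
    = b₁ * c₂ + b₂ * a₁ + a₂ * c₁ := rfl
  have h2 : Nat.add (Nat.add (Nat.mul b₁ a₂) (Nat.mul a₁ c₂)) (Nat.mul b₂ c₁)
    = b₁ * a₂ + a₁ * c₂ + b₂ * c₁ := rfl
  rw [h1, h2]
  push_cast
  ring

/-- The factor 14400 is 120², as each coordinate is measured in units of 1/120. -/
lemma crossSq_eq (a b c : WeightedPoint) :
    (crossSq a b c : ℝ) = (14400 * ‖edgeCross a.toSpace b.toSpace c.toSpace‖) ^ 2 := by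
  have h : crossSq a b c = natSq (planarArea a.y a.z b.y b.z c.y c.z)
    + (natSq (planarArea a.z a.x b.z b.x c.z c.x)
      + natSq (planarArea a.x a.y b.x b.y c.x c.y)) := rfl
  rw [h, mul_pow, norm_edgeCross_sq]
  push_cast
  rw [natSq_planarArea, natSq_planarArea, natSq_planarArea]
  simp [edgeCross, toSpace]
  ring

lemma weightedCross_eq (a b c : WeightedPoint) : weightedCross a b c
    = a.weight * b.weight * c.weight * (14400 * ‖edgeCross a.toSpace b.toSpace c.toSpace‖) := by
  rw [weightedCross, crossSq_eq, Real.sqrt_sq (by positivity)]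

lemma weightedCross_swap_left (a b c : WeightedPoint) :
    weightedCross a b c = weightedCross b a c := by
  have h : (crossSq a b c : ℝ) = crossSq b a c := by
    rw [crossSq_eq, crossSq_eq, mul_pow, mul_pow, norm_edgeCross_sq, norm_edgeCross_sq]
    simp [edgeCross]
    ring
  rw [weightedCross, weightedCross, h]
  ring

lemma weightedCross_swap_right (a b c : WeightedPoint) :
    weightedCross a b c = weightedCross a c b := by
  have h : (crossSq a b c : ℝ) = crossSq a c b := by
    rw [crossSq_eq, crossSq_eq, mul_pow, mul_pow, norm_edgeCross_sq, norm_edgeCross_sq]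
    simp [edgeCross]
    ring
  rw [weightedCross, weightedCross, h]
  ring

lemma lowerSum_le (a b : WeightedPoint) (l : List WeightedPoint) :
    (lowerSum a b l : ℝ) ≤ (l.map fun c => weightedCross a b c).sum := by
  induction l with
  | nil => simp [lowerSum]
  | cons c l ih =>
    have h : lowerSum a b (c :: l) = lowerTerm a b c + lowerSum a b l := rfl
    rw [h, List.map_cons, List.sum_cons]
    push_cast
    exact add_le_add (lowerTerm_le a b c) ih

lemma sum_map_nonneg {α : Type*} {f : α → ℝ} (hf : ∀ a, 0 ≤ f a) (l : List α) :
    0 ≤ (l.map f).sum :=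
  List.sum_nonneg (by simpa using fun a _ => hf a)

lemma lowerPairSum_le (a : WeightedPoint) (l : List WeightedPoint) :
    2 * (lowerPairSum a l : ℝ)
      ≤ (l.map fun b => (l.map fun c => weightedCross a b c).sum).sum := by
  induction l with
  | nil => simp [lowerPairSum]
  | cons b l ih =>
    have h : lowerPairSum a (b :: l) = lowerSum a b l + lowerPairSum a l := rfl
    have h1 := lowerSum_le a b l
    have h2 := weightedCross_nonneg a b b
    have h3 : (l.map fun c => weightedCross a c b) = l.map fun c => weightedCross a b c :=
      List.map_congr_left fun c _ => weightedCross_swap_right a c b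
    simp only [List.map_cons, List.sum_cons, List.sum_map_add, h3]
    rw [h]
    push_cast
    linarith

/-- By symmetry each unordered triple accounts for six ordered ones. Triples with a repeated list
position are dropped, which only needs their terms to be nonnegative. -/
lemma lowerTripleSum_le (l : List WeightedPoint) :
    6 * (lowerTripleSum l : ℝ) ≤ (l.map fun a => (l.map fun b =>
      (l.map fun c => weightedCross a b c).sum).sum).sum := by
  induction l with
  | nil => simp [lowerTripleSum]
  | cons a l ih =>
    have h : lowerTripleSum (a :: l) = lowerPairSum a l + lowerTripleSum l := rfl
    have h1 := lowerPairSum_le a l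
    have h2 := weightedCross_nonneg a a a
    have h3 := sum_map_nonneg (fun c => weightedCross_nonneg a a c) l
    have h4 := sum_map_nonneg (fun b => weightedCross_nonneg a b a) l
    have h5 := sum_map_nonneg (fun b => weightedCross_nonneg b a a) l
    have h6 : ∀ b, (l.map fun c => weightedCross b a c) = l.map fun c => weightedCross a b c :=
      fun b => List.map_congr_left fun c _ => weightedCross_swap_left b a c
    have h7 : ∀ b, (l.map fun c => weightedCross b c a) = l.map fun c => weightedCross a b c :=
      fun b => List.map_congr_left fun c _ => by
        rw [weightedCross_swap_right b c a, weightedCross_swap_left b a c]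
    simp only [List.map_cons, List.sum_cons, List.sum_map_add] at *
    simp only [h6, h7]
    rw [h]
    push_cast
    linarith

end WeightedPoint

/-! ### The 56 cells and the numerical evaluation -/

/-- The grid cells of width `1 / 6` that meet the interior of the tetrahedron. -/
def innerCells : List (ℕ × ℕ × ℕ) :=
  (List.range 6).flatMap fun i => (List.range (6 - i)).flatMap fun j =>
    (List.range (6 - i - j)).map fun k => (i, j, k)

/-- The centroid of the part of a grid cell inside the tetrahedron, weighted by six times the
fraction of the cell that this part makes up. -/
def cellPoint (p : ℕ × ℕ × ℕ) : WeightedPoint where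
  weight := partWeight (6 - cellHeight p)
  x := 20 * p.1 + partCentroid (6 - cellHeight p)
  y := 20 * p.2.1 + partCentroid (6 - cellHeight p)
  z := 20 * p.2.2 + partCentroid (6 - cellHeight p)

lemma cellHeight_le_of_mem {p : ℕ × ℕ × ℕ} (hp : p ∈ innerCells) : cellHeight p ≤ 5 := by
  simp only [innerCells, List.mem_flatMap, List.mem_map, List.mem_range] at hp
  obtain ⟨i, hi, j, hj, k, hk, rfl⟩ := hp
  simp only [cellHeight]
  omega

lemma nodup_innerCells : innerCells.Nodup := by decide +kernel

/-- The threshold is chosen so that, multiplied by 6 and divided by `216 ^ 3 * 14400`, it gives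
about 0.10853. -/
lemma lowerTripleSum_innerCells :
    2625000000 ≤ WeightedPoint.lowerTripleSum (innerCells.map cellPoint) := by
  decide +kernel

/-! ### Jensen's inequality for the cross product of independent points -/

/-- `f` is integrable with integral `v`. -/
def IntegratesTo {α : Type*} [MeasurableSpace α] (f : α → ℝ) (μ : Measure α) (v : ℝ) : Prop :=
  Integrable f μ ∧ ∫ x, f x ∂μ = v

namespace IntegratesTo

variable {α : Type*} [MeasurableSpace α] {f g : α → ℝ} {μ : Measure α} {v w : ℝ}

lemma add (hf : IntegratesTo f μ v) (hg : IntegratesTo g μ w) :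
    IntegratesTo (fun x => f x + g x) μ (v + w) :=
  ⟨hf.1.add hg.1, by rw [integral_add hf.1 hg.1, hf.2, hg.2]⟩

lemma sub (hf : IntegratesTo f μ v) (hg : IntegratesTo g μ w) :
    IntegratesTo (fun x => f x - g x) μ (v - w) :=
  ⟨hf.1.sub hg.1, by rw [integral_sub hf.1 hg.1, hf.2, hg.2]⟩

lemma const_mul (c : ℝ) (hf : IntegratesTo f μ v) : IntegratesTo (fun x => c * f x) μ (c * v) :=
  ⟨hf.1.const_mul c, by rw [integral_const_mul, hf.2]⟩

lemma congr (hf : IntegratesTo f μ v) (h : ∀ x, g x = f x) (hv : w = v) : IntegratesTo g μ w := by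
  obtain rfl : g = f := funext h
  rw [hv]
  exact hf

lemma pi_prod {n : ℕ} {E : Type*} [MeasurableSpace E] {μ : Fin n → Measure E}
    [∀ i, SigmaFinite (μ i)] {f : Fin n → E → ℝ} {v : Fin n → ℝ}
    (h : ∀ i, IntegratesTo (f i) (μ i) (v i)) :
    IntegratesTo (fun x : Fin n → E => ∏ i, f i (x i)) (Measure.pi μ) (∏ i, v i) :=
  ⟨Integrable.fintype_prod_dep fun i => (h i).1, by
    rw [integral_fintype_prod_eq_prod]
    exact Finset.prod_congr rfl fun i _ => (h i).2⟩

end IntegratesTo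

/-- `μ` has total mass `w` and barycentre `c`. -/
structure HasBarycenter (μ : Measure (EuclideanSpace ℝ (Fin 3))) (w : ℝ)
    (c : EuclideanSpace ℝ (Fin 3)) : Prop where
  mass : IntegratesTo (fun _ => 1) μ w
  coord : ∀ i, IntegratesTo (fun x => x i) μ (w * c i)

section Barycenter

variable {μ : Fin 3 → Measure (EuclideanSpace ℝ (Fin 3))} [∀ i, SigmaFinite (μ i)]
  {w : Fin 3 → ℝ} {c : Fin 3 → EuclideanSpace ℝ (Fin 3)}

lemma integratesTo_coord_mul_coord (h : ∀ i, HasBarycenter (μ i) (w i) (c i)) {i j : Fin 3}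
    (hij : i ≠ j) (α β : Fin 3) :
    IntegratesTo (fun x : Fin 3 → EuclideanSpace ℝ (Fin 3) => x i α * x j β) (Measure.pi μ)
      (w 0 * w 1 * w 2 * (c i α * c j β)) := by
  -- The third point contributes the constant factor 1, hence its total mass.
  have key := IntegratesTo.pi_prod (μ := μ)
    (f := fun l x => if l = i then x α else if l = j then x β else 1)
    (v := fun l => if l = i then w l * c l α else if l = j then w l * c l β else w l)
    (fun l => by
      by_cases h1 : l = i
      · simpa only [h1, if_true] using (h i).coord α
      · by_cases h2 : l = j
        · simpa only [h2, if_true, if_neg hij.symm] using (h j).coord β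
        · simpa only [h1, h2, if_false] using (h l).mass)
  refine key.congr (fun x => ?_) ?_ <;> rw [Fin.prod_univ_three] <;>
    fin_cases i <;> fin_cases j <;> simp at hij ⊢ <;> ring

/-- On expansion the products of two coordinates of the same point cancel. What remains is bilinear
in distinct points, so barycentres determine the integral. -/
lemma integratesTo_planarDet (h : ∀ i, HasBarycenter (μ i) (w i) (c i)) (α β : Fin 3) :
    IntegratesTo (fun x : Fin 3 → EuclideanSpace ℝ (Fin 3) =>
        (x 1 α - x 0 α) * (x 2 β - x 0 β) - (x 1 β - x 0 β) * (x 2 α - x 0 α)) (Measure.pi μ)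
      (w 0 * w 1 * w 2 * ((c 1 α - c 0 α) * (c 2 β - c 0 β)
        - (c 1 β - c 0 β) * (c 2 α - c 0 α))) := by
  have m := fun {i j : Fin 3} (hij : i ≠ j) => integratesTo_coord_mul_coord h hij
  have h12 : (1 : Fin 3) ≠ 2 := by decide
  have h10 : (1 : Fin 3) ≠ 0 := by decide
  have h02 : (0 : Fin 3) ≠ 2 := by decide
  refine (((((m h12 α β).sub (m h10 α β)).sub (m h02 α β)).sub
    (((m h12 β α).sub (m h10 β α)).sub (m h02 β α)))).congr (fun x => ?_) ?_ <;> ring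

lemma mul_norm_edgeCross_le (hw : ∀ i, 0 ≤ w i) (h : ∀ i, HasBarycenter (μ i) (w i) (c i)) :
    w 0 * w 1 * w 2 * ‖edgeCross (c 0) (c 1) (c 2)‖
      ≤ ∫ x, ‖edgeCross (x 0) (x 1) (x 2)‖ ∂Measure.pi μ := by
  have h0 := integratesTo_planarDet h 1 2
  have h1 := integratesTo_planarDet h 2 0
  have h2 := integratesTo_planarDet h 0 1
  have hint : ∀ i, Integrable (fun x : Fin 3 → EuclideanSpace ℝ (Fin 3) =>
      edgeCross (x 0) (x 1) (x 2) i) (Measure.pi μ) := by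
    intro i
    fin_cases i
    exacts [h0.1, h1.1, h2.1]
  have hval : ∫ x, edgeCross (x 0) (x 1) (x 2) ∂Measure.pi μ
      = (w 0 * w 1 * w 2) • edgeCross (c 0) (c 1) (c 2) := by
    ext i
    rw [eval_integral_piLp hint, PiLp.smul_apply, smul_eq_mul]
    fin_cases i
    exacts [h0.2, h1.2, h2.2]
  have hnorm := norm_integral_le_integral_norm (μ := Measure.pi μ)
    (fun x : Fin 3 → EuclideanSpace ℝ (Fin 3) => edgeCross (x 0) (x 1) (x 2))
  rwa [hval, norm_smul, Real.norm_of_nonneg (mul_nonneg (mul_nonneg (hw 0) (hw 1)) (hw 2))]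
    at hnorm

end Barycenter

lemma continuous_edgeCross {X : Type*} [TopologicalSpace X]
    {f g h : X → EuclideanSpace ℝ (Fin 3)} (hf : Continuous f) (hg : Continuous g)
    (hh : Continuous h) : Continuous fun x => edgeCross (f x) (g x) (h x) := by
  refine (PiLp.continuous_toLp 2 _).comp (continuous_pi fun i => ?_)
  fin_cases i <;> simp <;> fun_prop

/-! ### The uniform distribution and the lower bound -/

/-- The uniform distribution on the tetrahedron. -/
noncomputable def unif : Measure (EuclideanSpace ℝ (Fin 3)) := ProbabilityTheory.cond volume T₃

lemma volume_T₃ : volume T₃ = ENNReal.ofReal (1 / 6) := by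
  have h := setIntegral_T₃_one
  rw [setIntegral_const, smul_eq_mul, mul_one, Measure.real] at h
  rw [← h, ENNReal.ofReal_toReal isCompact_T₃.measure_lt_top.ne]

instance : IsProbabilityMeasure unif :=
  ProbabilityTheory.cond_isProbabilityMeasure_of_finite (by rw [volume_T₃]; simp)
    isCompact_T₃.measure_lt_top.ne

lemma unif_eq : unif = ENNReal.ofReal 6 • volume.restrict T₃ := by
  rw [unif, ProbabilityTheory.cond, volume_T₃, ← ENNReal.ofReal_inv_of_pos (by norm_num)]
  norm_num

lemma integrable_unif {f : EuclideanSpace ℝ (Fin 3) → ℝ} (hf : Continuous f) :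
    Integrable f unif := by
  rw [unif_eq]
  exact (integrableOn_T₃ hf).smul_measure ENNReal.ofReal_ne_top

lemma setIntegral_unif {s : Set (EuclideanSpace ℝ (Fin 3))} (hs : MeasurableSet s)
    (f : EuclideanSpace ℝ (Fin 3) → ℝ) : ∫ x in s, f x ∂unif = 6 * ∫ x in s ∩ T₃, f x := by
  rw [unif_eq, Measure.restrict_smul, integral_smul_measure, Measure.restrict_restrict hs,
    ENNReal.toReal_ofReal (by norm_num), smul_eq_mul]

lemma integral_unif (f : EuclideanSpace ℝ (Fin 3) → ℝ) :
    ∫ x, f x ∂unif = 6 * ∫ x in T₃, f x := by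
  rw [← setIntegral_univ, setIntegral_unif MeasurableSet.univ, Set.univ_inter]

lemma hasBarycenter_cell {p : ℕ × ℕ × ℕ} (hp : cellHeight p ≤ 5) :
    HasBarycenter (unif.restrict (cell p)) ((cellPoint p).weight / 216) (cellPoint p).toSpace where
  mass := by
    refine ⟨integrable_const _, ?_⟩
    rw [setIntegral_unif (measurableSet_cell p), setIntegral_cell_one hp]
    simp only [cellPoint]
    ring
  coord i := by
    refine ⟨(integrable_unif (by fun_prop)).restrict, ?_⟩
    rw [setIntegral_unif (measurableSet_cell p), setIntegral_cell_coord hp]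
    have : (cellPoint p).toSpace i
        = (cellCorner p i * 20 + partCentroid (6 - cellHeight p)) / 120 := by
      fin_cases i <;> simp [cellPoint, WeightedPoint.toSpace, cellCorner, mul_comm]
    rw [this]
    simp only [cellPoint]
    ring

lemma ae_pi_mem_T₃ (n : ℕ) : ∀ᵐ x ∂(Measure.pi fun _ : Fin n => unif), ∀ i, x i ∈ T₃ := by
  have h : ∀ᵐ y ∂unif, y ∈ T₃ := by
    rw [unif_eq]
    exact Measure.ae_smul_measure (ae_restrict_mem isCompact_T₃.measurableSet) _
  exact ae_all_iff.2 fun i => Measure.tendsto_eval_ae_ae.eventually h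

lemma integrable_pi_unif {n : ℕ} {f : (Fin n → EuclideanSpace ℝ (Fin 3)) → ℝ}
    (hf : Continuous f) : Integrable f (Measure.pi fun _ => unif) := by
  obtain ⟨C, hC⟩ := (isCompact_univ_pi fun _ : Fin n => isCompact_T₃).exists_bound_of_continuousOn
    hf.continuousOn
  refine Integrable.of_bound hf.aestronglyMeasurable C ?_
  filter_upwards [ae_pi_mem_T₃ n] with x hx
  exact hC x fun i _ => hx i

/-- The set of triples of points in given grid cells. -/
def cellBox (t : (ℕ × ℕ × ℕ) × (ℕ × ℕ × ℕ) × (ℕ × ℕ × ℕ)) :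
    Set (Fin 3 → EuclideanSpace ℝ (Fin 3)) :=
  Set.univ.pi fun i => cell (![t.1, t.2.1, t.2.2] i)

lemma cellBox_le {t : (ℕ × ℕ × ℕ) × (ℕ × ℕ × ℕ) × (ℕ × ℕ × ℕ)} (h0 : t.1 ∈ innerCells)
    (h1 : t.2.1 ∈ innerCells) (h2 : t.2.2 ∈ innerCells) :
    (1 / (216 ^ 3 * 14400)) * WeightedPoint.weightedCross (cellPoint t.1) (cellPoint t.2.1)
        (cellPoint t.2.2)
      ≤ ∫ x in cellBox t, ‖edgeCross (x 0) (x 1) (x 2)‖ ∂Measure.pi fun _ => unif := by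
  have hp : ∀ i, cellHeight (![t.1, t.2.1, t.2.2] i) ≤ 5 := by
    intro i
    fin_cases i
    exacts [cellHeight_le_of_mem h0, cellHeight_le_of_mem h1, cellHeight_le_of_mem h2]
  have h := mul_norm_edgeCross_le
    (μ := fun i => unif.restrict (cell (![t.1, t.2.1, t.2.2] i)))
    (w := fun i => (cellPoint (![t.1, t.2.1, t.2.2] i)).weight / 216)
    (c := fun i => (cellPoint (![t.1, t.2.1, t.2.2] i)).toSpace)
    (fun i => by positivity) (fun i => hasBarycenter_cell (hp i))
  rw [cellBox, Measure.restrict_pi_pi]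
  refine le_trans (le_of_eq ?_) h
  rw [WeightedPoint.weightedCross_eq]
  simp only [Matrix.cons_val]
  ring

lemma le_sum_weightedCross :
    (6 * 2625000000 : ℝ) ≤ ((innerCells.map cellPoint).map fun a =>
      ((innerCells.map cellPoint).map fun b => ((innerCells.map cellPoint).map fun c =>
        WeightedPoint.weightedCross a b c).sum).sum).sum := by
  refine le_trans (mul_le_mul_of_nonneg_left ?_ (by norm_num))
    (WeightedPoint.lowerTripleSum_le (innerCells.map cellPoint))
  exact (Nat.cast_ofNat (R := ℝ) (n := 2625000000)).symm.le.trans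
    (Nat.cast_le.2 lowerTripleSum_innerCells)

/-- Disjointness of the cells suffices: the integrand is nonnegative, so it need not be shown that
they cover the tetrahedron. -/
lemma sum_weightedCross_le_integral {S : Finset (ℕ × ℕ × ℕ)} (hS : ∀ p ∈ S, p ∈ innerCells) :
    (1 / (216 ^ 3 * 14400)) * ∑ t ∈ S ×ˢ S ×ˢ S, WeightedPoint.weightedCross (cellPoint t.1)
        (cellPoint t.2.1) (cellPoint t.2.2)
      ≤ ∫ x, ‖edgeCross (x 0) (x 1) (x 2)‖ ∂Measure.pi fun _ : Fin 3 => unif := by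
  have hint : Integrable (fun x : Fin 3 → EuclideanSpace ℝ (Fin 3) =>
      ‖edgeCross (x 0) (x 1) (x 2)‖) (Measure.pi fun _ : Fin 3 => unif) :=
    integrable_pi_unif (continuous_edgeCross (by fun_prop) (by fun_prop) (by fun_prop)).norm
  have hunion := integral_biUnion_finset (μ := Measure.pi fun _ : Fin 3 => unif)
    (f := fun x : Fin 3 → EuclideanSpace ℝ (Fin 3) => ‖edgeCross (x 0) (x 1) (x 2)‖)
    (s := cellBox) (S ×ˢ S ×ˢ S) (fun t _ => MeasurableSet.univ_pi fun i => measurableSet_cell _)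
    (fun t _ u _ htu => by
      refine Set.disjoint_left.2 fun x hx hx' => htu ?_
      have h0 := cell_eq_of_mem (hx 0 trivial) (hx' 0 trivial)
      have h1 := cell_eq_of_mem (hx 1 trivial) (hx' 1 trivial)
      have h2 := cell_eq_of_mem (hx 2 trivial) (hx' 2 trivial)
      exact Prod.ext h0 (Prod.ext h1 h2))
    (fun t _ => hint.integrableOn)
  refine le_trans ?_ (setIntegral_le_integral (s := ⋃ t ∈ S ×ˢ S ×ˢ S, cellBox t) hint
    (Filter.Eventually.of_forall fun _ => norm_nonneg _))
  rw [hunion, Finset.mul_sum]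
  refine Finset.sum_le_sum fun t ht => ?_
  simp only [Finset.mem_product] at ht
  exact cellBox_le (hS _ ht.1) (hS _ ht.2.1) (hS _ ht.2.2)

lemma le_integral_norm_edgeCross :
    (0.1085 : ℝ) ≤ ∫ x, ‖edgeCross (x 0) (x 1) (x 2)‖ ∂Measure.pi fun _ : Fin 3 => unif := by
  refine le_trans ?_ (sum_weightedCross_le_integral (S := innerCells.toFinset)
    fun p hp => List.mem_toFinset.1 hp)
  have h := le_sum_weightedCross
  simp only [List.map_map, Function.comp_def] at h
  simp only [Finset.sum_product, List.sum_toFinset _ nodup_innerCells]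
  calc (0.1085 : ℝ) ≤ (1 / (216 ^ 3 * 14400)) * (6 * 2625000000) := by norm_num
    _ ≤ _ := mul_le_mul_of_nonneg_left h (by norm_num)

/-! ### Second moments about the facet centroid and the upper bound -/

lemma integral_unif_coord (α : Fin 3) : ∫ x, x α ∂unif = 1 / 4 := by
  rw [integral_unif, setIntegral_T₃_coord]
  norm_num

lemma integral_unif_coord_mul_coord (α β : Fin 3) :
    ∫ x, x α * x β ∂unif = if α = β then 1 / 10 else 1 / 20 := by
  have h00 := setIntegral_T₃_monomial 2 0 0
  have h11 := setIntegral_T₃_monomial 0 2 0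
  have h22 := setIntegral_T₃_monomial 0 0 2
  have h01 := setIntegral_T₃_monomial 1 1 0
  have h02 := setIntegral_T₃_monomial 1 0 1
  have h12 := setIntegral_T₃_monomial 0 1 1
  simp only [pow_zero, pow_one, mul_one, one_mul, Nat.factorial, sq] at h00 h11 h22 h01 h02 h12
  have h10 : ∫ x in T₃, x 1 * x 0 = ∫ x in T₃, x 0 * x 1 := by simp only [mul_comm]
  have h20 : ∫ x in T₃, x 2 * x 0 = ∫ x in T₃, x 0 * x 2 := by simp only [mul_comm]
  have h21 : ∫ x in T₃, x 2 * x 1 = ∫ x in T₃, x 1 * x 2 := by simp only [mul_comm]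
  rw [integral_unif]
  fin_cases α <;> fin_cases β <;>
    simp only [Fin.zero_eta, Fin.mk_one, Fin.reduceFinMk, h10, h20, h21, h00, h11, h22, h01, h02,
      h12] <;> norm_num <;> decide

lemma integratesTo_centered (α β : Fin 3) :
    IntegratesTo (fun x : EuclideanSpace ℝ (Fin 3) => (x α - 1 / 3) * (x β - 1 / 3)) unif
      (if α = β then 2 / 45 else -1 / 180) := by
  have h1 : IntegratesTo (fun x : EuclideanSpace ℝ (Fin 3) => x α * x β) unif _ :=
    ⟨integrable_unif (by fun_prop), integral_unif_coord_mul_coord α β⟩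
  have h2 : ∀ γ : Fin 3, IntegratesTo (fun x : EuclideanSpace ℝ (Fin 3) => x γ) unif _ :=
    fun γ => ⟨integrable_unif (by fun_prop), integral_unif_coord γ⟩
  have h3 : IntegratesTo (fun _ : EuclideanSpace ℝ (Fin 3) => (1 : ℝ)) unif 1 :=
    ⟨integrable_const _, by simp⟩
  refine (((h1.sub ((h2 α).const_mul (1 / 3))).sub ((h2 β).const_mul (1 / 3))).add
    (h3.const_mul (1 / 9))).congr (fun x => by ring) ?_
  split_ifs <;> norm_num

lemma integratesTo_centered_det_sq {α β : Fin 3} (hαβ : α ≠ β) :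
    IntegratesTo (fun x : Fin 2 → EuclideanSpace ℝ (Fin 3) =>
        ((x 0 α - 1 / 3) * (x 1 β - 1 / 3) - (x 0 β - 1 / 3) * (x 1 α - 1 / 3)) ^ 2)
      (Measure.pi fun _ => unif) (7 / 1800) := by
  have key := fun α β γ δ : Fin 3 => IntegratesTo.pi_prod (μ := fun _ : Fin 2 => unif)
    (f := ![fun x => (x α - 1 / 3) * (x β - 1 / 3), fun x => (x γ - 1 / 3) * (x δ - 1 / 3)])
    (v := ![if α = β then 2 / 45 else -1 / 180, if γ = δ then 2 / 45 else -1 / 180])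
    (fun i => by
      fin_cases i
      exacts [integratesTo_centered α β, integratesTo_centered γ δ])
  simp only [Fin.prod_univ_two, Matrix.cons_val_zero, Matrix.cons_val_one] at key
  -- Expanding the square gives products of second moments of independent points: 2 · (2/45)² - 2 ·
  -- (1/180)² = 7/1800.
  refine (((key α α β β).add (key β β α α)).sub ((key α β α β).const_mul 2)).congr
    (fun x => by ring) ?_
  simp only [if_true, if_neg hαβ]
  norm_num

lemma integral_norm_edgeCross_c₃_le :
    ∫ x, ‖edgeCross c₃ (x 0) (x 1)‖ ∂(Measure.pi fun _ : Fin 2 => unif) ≤ 0.1081 := by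
  have hsq : IntegratesTo (fun x : Fin 2 → EuclideanSpace ℝ (Fin 3) =>
      ‖edgeCross c₃ (x 0) (x 1)‖ ^ 2) (Measure.pi fun _ : Fin 2 => unif) (7 / 600) := by
    refine (((integratesTo_centered_det_sq (show (1 : Fin 3) ≠ 2 by decide)).add
      (integratesTo_centered_det_sq (show (2 : Fin 3) ≠ 0 by decide))).add
      (integratesTo_centered_det_sq (show (0 : Fin 3) ≠ 1 by decide))).congr (fun x => ?_)
      (by norm_num)
    rw [norm_edgeCross_sq]
    simp [edgeCross, c₃]
  have hone : IntegratesTo (fun _ : Fin 2 → EuclideanSpace ℝ (Fin 3) => (1 : ℝ))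
      (Measure.pi fun _ => unif) 1 := ⟨integrable_const _, by simp⟩
  have hub := (hsq.const_mul (1 / 0.216)).add (hone.const_mul 0.054)
  have hcont : Continuous fun x : Fin 2 → EuclideanSpace ℝ (Fin 3) =>
      ‖edgeCross c₃ (x 0) (x 1)‖ :=
    (continuous_edgeCross (by fun_prop) (by fun_prop) (by fun_prop)).norm
  refine (integral_mono (integrable_pi_unif hcont) hub.1 fun x => ?_).trans ?_
  -- This is `t ≤ t ^ 2 / (2 * s) + s / 2` with `s = 0.108`, close to the optimal √(7/600).
  · nlinarith [sq_nonneg (‖edgeCross c₃ (x 0) (x 1)‖ - 0.108)]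
  · rw [hub.2]
    norm_num

/-! ### Conclusion -/

lemma uniformPointsLaw_T₃ (n : ℕ) : uniformPointsLaw T₃ n = Measure.pi fun _ => unif := rfl

theorem proposition2 :
    Integrable (fun x : Fin 2 → EuclideanSpace ℝ (Fin 3) =>
        simplexVolume (Fin.cons c₃ x : Fin 3 → EuclideanSpace ℝ (Fin 3))) (uniformPointsLaw T₃ 2) ∧
      Integrable (fun x : Fin 3 → EuclideanSpace ℝ (Fin 3) => simplexVolume x)
        (uniformPointsLaw T₃ 3) ∧
      expectedVolumeFixed T₃ 2 c₃ < expectedVolume T₃ 2 := by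
  have hfix : ∀ x : Fin 2 → EuclideanSpace ℝ (Fin 3),
      simplexVolume (Fin.cons c₃ x : Fin 3 → EuclideanSpace ℝ (Fin 3))
        = (volume stdTriangle).toReal * ‖edgeCross c₃ (x 0) (x 1)‖ := fun x => simplexVolume_eq _
  simp only [expectedVolumeFixed, expectedVolume, uniformPointsLaw_T₃, hfix, simplexVolume_eq]
  refine ⟨(integrable_pi_unif ?_).const_mul _, (integrable_pi_unif ?_).const_mul _, ?_⟩
  · exact (continuous_edgeCross (by fun_prop) (by fun_prop) (by fun_prop)).norm
  · exact (continuous_edgeCross (by fun_prop) (by fun_prop) (by fun_prop)).norm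
  · rw [integral_const_mul, integral_const_mul]
    refine mul_lt_mul_of_pos_left ?_ volume_stdTriangle_pos
    calc _ ≤ (0.1081 : ℝ) := integral_norm_edgeCross_c₃_le
      _ < 0.1085 := by norm_num
      _ ≤ _ := le_integral_norm_edgeCross
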